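/- Let $G$ be a finite simple graph without isolated vertices, with vertex set $\{x_1,\dots,x_n\}$, let $K$ be a field, and let $I(G)\subseteq S=K[x_1,\dots,x_n]$ be its edge ideal, generated by the monomials $x_ix_j$ with $\{x_i,x_j\}$ an edge of $G$. For $q\ge 1$ let $\mathcal G(I(G)^q)$ denote the minimal set of monomial generators of $I(G)^q$. A finite set $\mathcal B$ of monomials of $S$ is called a polymatroid if all its members have the same degree and, whenever $u=x_1^{a_1}\cdots x_n^{a_n}$ and $v=x_1^{b_1}\cdots x_n^{b_n}$ belong to $\mathcal B$ and $a_\xi>b_\xi$, there is $\rho$ with $a_\rho<b_\rho$ and $x_\rho(u/x_\xi)\in\mathcal B$. The toric ideal $J_{\mathcal B}$ is the kernel of the $K$-algebra homomorphism $K[z_w : w\in\mathcal B]\to S$, $z_w\mapsto w$. A symmetric exchange binomial of $\mathcal B$ is a binomial $z_uz_v-z_{u'}z_{v'}$ with $u=x_1^{a_1}\cdots x_n^{a_n}$, $v=x_1^{b_1}\cdots x_n^{b_n}$ in $\mathcal B$, $a_\xi>b_\xi$, $a_\rho<b_\rho$, where $u'=x_\rho(u/x_\xi)$ and $v'=x_\xi(v/x_\rho)$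 both belong to $\mathcal B$. Theorem. The following conditions are equivalent: (i) $\mathcal G(I(G)^q)$ is a polymatroid for some $q\ge 1$; (ii) $\mathcal G(I(G)^q)$ is a polymatroid for all $q\ge 1$; (iii) $G$ is a complete multipartite graph. Furthermore, if $G$ is a complete multipartite graph, then for all $q\ge 1$ the toric ideal $J_{\mathcal G(I(G)^q)}$ is generated by the symmetric exchange binomials of $\mathcal G(I(G)^q)$. -/

import Mathlib

open MvPolynomial

/-! Monomials `x ^ a` in the variables `x_v`, `v : σ`, are represented by their exponent vectors
`a : σ →₀ ℕ`; the corresponding element of `K[x_v : v ∈ σ]` is `monomial a 1`. Divisibility of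
monomials is the order `≤` of exponent vectors. -/

namespace EdgeIdealPowers

/-- A finite set `B` of monomials is a polymatroid (the set of bases of a discrete polymatroid):
all members have the same degree, and whenever `a, b ∈ B` with `a ξ > b ξ`, there is `ρ` with
`a ρ < b ρ` and `x_ρ (x ^ a / x_ξ) ∈ B`. -/
def IsPolymatroid {σ : Type*} (B : Set (σ →₀ ℕ)) : Prop :=
  B.Finite ∧
  (∀ a ∈ B, ∀ b ∈ B, a.degree = b.degree) ∧
  ∀ a ∈ B, ∀ b ∈ B, ∀ ξ : σ, b ξ < a ξ →
    ∃ ρ : σ, a ρ < b ρ ∧ a - Finsupp.single ξ 1 + Finsupp.single ρ 1 ∈ B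

/-- The edge ideal `I(G)`, generated by the products `x_v x_w` over the edges `{v, w}` of `G`. -/
noncomputable def edgeIdeal (K : Type*) [Field K] {V : Type*} (G : SimpleGraph V) :
    Ideal (MvPolynomial V K) :=
  Ideal.span {f | ∃ v w : V, G.Adj v w ∧ f = X v * X w}

/-- The minimal set of monomial generators of a monomial ideal `I`: the monomials in `I` which are
minimal with respect to divisibility. -/
def minimalGenerators {K : Type*} [Field K] {σ : Type*} (I : Ideal (MvPolynomial σ K)) :
    Set (σ →₀ ℕ) :=
  {a | Minimal (fun b : σ →₀ ℕ => monomial b (1 : K) ∈ I) a}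

/-- For a monomial ideal `I`, i.e. one generated by a set `S` of monomials, `minimalGenerators I`
generates `I`. -/
theorem span_minimalGenerators {K : Type*} [Field K] {σ : Type*} [Finite σ]
    (I : Ideal (MvPolynomial σ K)) (S : Set (σ →₀ ℕ))
    (hS : Ideal.span ((fun a => monomial a (1 : K)) '' S) = I) :
    Ideal.span ((fun a => monomial a (1 : K)) '' minimalGenerators I) = I := by
  classical
  apply le_antisymm
  · rw [Ideal.span_le]
    rintro _ ⟨a, ha, rfl⟩
    exact (show Minimal (fun b : σ →₀ ℕ => monomial b (1 : K) ∈ I) a from ha).prop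
  · conv_lhs => rw [← hS]
    rw [Ideal.span_le]
    rintro _ ⟨s, hs, rfl⟩
    have hsI : monomial s (1 : K) ∈ I := hS ▸ Ideal.subset_span ⟨s, hs, rfl⟩
    obtain ⟨m, hms, hm⟩ :=
      exists_minimal_le_of_wellFoundedLT (fun b : σ →₀ ℕ => monomial b (1 : K) ∈ I) s hsI
    refine (mem_ideal_span_monomial_image).2 fun t ht => ?_
    have : t = s := by
      by_contra hne
      rw [mem_support_iff, coeff_monomial, if_neg (Ne.symm hne)] at ht
      exact ht rfl
    exact ⟨m, hm, this ▸ hms⟩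

/-- Every set of monomials generating `I` contains `minimalGenerators I`. -/
theorem minimalGenerators_subset {K : Type*} [Field K] {σ : Type*}
    (I : Ideal (MvPolynomial σ K)) (S : Set (σ →₀ ℕ))
    (hS : Ideal.span ((fun a => monomial a (1 : K)) '' S) = I) :
    minimalGenerators I ⊆ S := by
  classical
  intro a ha
  replace ha : Minimal (fun b : σ →₀ ℕ => monomial b (1 : K) ∈ I) a := ha
  have h : monomial a (1 : K) ∈ Ideal.span ((fun a => monomial a (1 : K)) '' S) := hS ▸ ha.prop
  obtain ⟨s, hs, hsa⟩ := (mem_ideal_span_monomial_image).1 h a (by simp [mem_support_iff, coeff_monomial])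
  have hsI : monomial s (1 : K) ∈ I := hS ▸ Ideal.subset_span ⟨s, hs, rfl⟩
  exact le_antisymm hsa (ha.le_of_le hsI hsa) ▸ hs

/-- The toric ideal `J_B` of a set of monomials `B`: the kernel of the `K`-algebra homomorphism
`K[z_w : w ∈ B] → K[x_v : v ∈ σ]` with `z_w ↦ w` (whose image is the base ring `K[B]`). -/
noncomputable def toricIdeal (K : Type*) [Field K] {σ : Type*} (B : Set (σ →₀ ℕ)) :
    Ideal (MvPolynomial B K) :=
  RingHom.ker (aeval (fun w : B => monomial (w : σ →₀ ℕ) (1 : K)) :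
    MvPolynomial B K →ₐ[K] MvPolynomial σ K)

/-- The symmetric exchange binomials `z_a z_b - z_a' z_b'` of `B`, where `a, b, a', b' ∈ B`,
`a ξ > b ξ`, `a ρ < b ρ`, `a' = x_ρ (a / x_ξ)` and `b' = x_ξ (b / x_ρ)`. -/
def symmetricExchangeBinomials (K : Type*) [Field K] {σ : Type*} (B : Set (σ →₀ ℕ)) :
    Set (MvPolynomial B K) :=
  {f | ∃ (a b a' b' : B) (ξ ρ : σ),
    (b : σ →₀ ℕ) ξ < (a : σ →₀ ℕ) ξ ∧ (a : σ →₀ ℕ) ρ < (b : σ →₀ ℕ) ρ ∧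
    (a' : σ →₀ ℕ) = (a : σ →₀ ℕ) - Finsupp.single ξ 1 + Finsupp.single ρ 1 ∧
    (b' : σ →₀ ℕ) = (b : σ →₀ ℕ) - Finsupp.single ρ 1 + Finsupp.single ξ 1 ∧
    f = X a * X b - X a' * X b'}

end EdgeIdealPowers

/-! All generators of `I(G)^q` have degree `2q`, so the minimal ones are exactly the `q`-fold
products of edges. If `G` is complete multipartite, these are the monomials of degree `2q` whose
exponents sum to at most `q` on every part (`nsmul_edgeVectors_eq_cappedBlocks`), and such capped
sets satisfy the exchange property. Conversely, if `x, y` and `y, z` are non-adjacent while `xz` and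
`yw` are edges, then exchanging `w` out of `(yw)^q` against `(xz)^q` leaves `y^q` with only `q - 1`
factors from the neighbourhood of `y`, so it is not a product of `q` edges.

For the toric ideal it suffices that any two tuples of generators with equal product are linked by
symmetric exchanges. Order the variables with each part contiguous. A tuple is sorted when, at every
cut of this order, its members have initial degrees as equal as possible, ties broken by position; a
sorted tuple is determined by its product. An unsorted tuple admits an exchange lowering a sum of
squares. To respect the caps, the parts are balanced as blocks first; the exchanges between single
variables that follow then stay inside one part. -/

namespace EdgeIdealPowers

/-! ### Initial sums, block sums and capped sets of monomials -/

section PartialSums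

variable {V : Type*} [Fintype V]

/-- The total exponent of `a` on the variables with key less than `m`. -/
def initialSum (k : V → ℕ) (m : ℕ) (a : V →₀ ℕ) : ℕ := ∑ x with k x < m, a x

/-- The total exponent of `a` on the variables with key `p`. -/
def blockSum (k : V → ℕ) (p : ℕ) (a : V →₀ ℕ) : ℕ := ∑ x with k x = p, a x

theorem sub_single_add_single {σ : Type*} {a : σ →₀ ℕ} {ξ ρ : σ} (h : 0 < a ξ) :
    a - Finsupp.single ξ 1 + Finsupp.single ρ 1 + Finsupp.single ξ 1 =
      a + Finsupp.single ρ 1 := by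
  rw [add_right_comm, tsub_add_cancel_of_le]
  simpa [Finsupp.single_le_iff] using Nat.succ_le_of_lt h

theorem sum_finset_exchange {a b : V →₀ ℕ} {ξ ρ : V}
    (h : b + Finsupp.single ξ 1 = a + Finsupp.single ρ 1) (p : V → Prop) [DecidablePred p] :
    ∑ x with p x, b x + (if p ξ then 1 else 0) = ∑ x with p x, a x + (if p ρ then 1 else 0) := by
  classical
  have h' := congrArg (fun c : V →₀ ℕ => ∑ x with p x, c x) h
  simpa [Finset.sum_add_distrib, Finsupp.single_apply, Finset.sum_ite_eq] using h'

theorem initialSum_exchange {a b : V →₀ ℕ} {ξ ρ : V}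
    (h : b + Finsupp.single ξ 1 = a + Finsupp.single ρ 1) (k : V → ℕ) (m : ℕ) :
    initialSum k m b + (if k ξ < m then 1 else 0) =
      initialSum k m a + (if k ρ < m then 1 else 0) :=
  sum_finset_exchange h _

theorem blockSum_exchange {a b : V →₀ ℕ} {ξ ρ : V}
    (h : b + Finsupp.single ξ 1 = a + Finsupp.single ρ 1) (k : V → ℕ) (p : ℕ) :
    blockSum k p b + (if k ξ = p then 1 else 0) =
      blockSum k p a + (if k ρ = p then 1 else 0) :=
  sum_finset_exchange h _

theorem degree_exchange {σ : Type*} {a b : σ →₀ ℕ} {ξ ρ : σ}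
    (h : b + Finsupp.single ξ 1 = a + Finsupp.single ρ 1) : b.degree = a.degree := by
  have h' := congrArg Finsupp.degree h
  simpa [map_add] using h'

theorem initialSum_add_one (k : V → ℕ) (m : ℕ) (a : V →₀ ℕ) :
    initialSum k (m + 1) a = initialSum k m a + blockSum k m a := by
  simp only [initialSum, blockSum, Finset.sum_filter, ← Finset.sum_add_distrib]
  refine Finset.sum_congr rfl fun x _ => ?_
  split_ifs <;> omega

theorem initialSum_zero (k : V → ℕ) (a : V →₀ ℕ) : initialSum k 0 a = 0 := by
  simp [initialSum]

theorem initialSum_eq_degree {k : V → ℕ} {m : ℕ} (h : ∀ x, k x < m) (a : V →₀ ℕ) :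
    initialSum k m a = a.degree := by
  simp [initialSum, h, Finsupp.degree_eq_sum]

theorem blockSum_of_injective {k : V → ℕ} (hk : Function.Injective k) (x : V) (a : V →₀ ℕ) :
    blockSum k (k x) a = a x := by
  classical
  simp [blockSum, hk.eq_iff, Finset.sum_filter]

theorem initialSum_sum {ι : Type*} [Fintype ι] (k : V → ℕ) (m : ℕ) (U : ι → V →₀ ℕ) :
    initialSum k m (∑ i, U i) = ∑ i, initialSum k m (U i) := by
  simp only [initialSum, Finsupp.finsetSum_apply]
  exact Finset.sum_comm

/-- The set of monomials of degree `d` whose exponents sum to at most `c` on every fibre of `k`. -/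
def cappedBlocks (k : V → ℕ) (d c : ℕ) : Set (V →₀ ℕ) :=
  {a | a.degree = d ∧ ∀ p, blockSum k p a ≤ c}

theorem cappedBlocks_of_exchange {k : V → ℕ} {d c : ℕ} {a b : V →₀ ℕ} {ξ ρ : V}
    (ha : a ∈ cappedBlocks k d c) (h : b + Finsupp.single ξ 1 = a + Finsupp.single ρ 1)
    (hρ : k ξ = k ρ ∨ blockSum k (k ρ) a < c) : b ∈ cappedBlocks k d c := by
  refine ⟨(degree_exchange h).trans ha.1, fun p => ?_⟩
  have h1 := blockSum_exchange h k p
  have h2 := ha.2 p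
  by_cases hp : k ρ = p
  · subst hp
    rcases hρ with hρ | hρ
    · simp only [hρ, if_true] at h1
      omega
    · rw [if_pos rfl] at h1
      omega
  · rw [if_neg hp] at h1
    omega

/-- Here `a + 1` is the first point where the maximum of `f` is attained and `b` is the end of the
plateau starting there. In the application `f` is the difference of the initial sums of two members:
the rise at `a` and the fall at `b` locate the two blocks to exchange. -/
theorem exists_peak {f : ℕ → ℤ} {L m : ℕ} (h0 : f 0 ≤ 0) (hL : ∀ n, L ≤ n → f n ≤ 0)
    (hm : 0 < f m) : ∃ a b, a < b ∧ f a < f (a + 1) ∧ f (b + 1) < f b ∧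
      ∀ n, a < n → n ≤ b → f m ≤ f n := by
  classical
  obtain ⟨x, -, hx⟩ := Finset.exists_max_image (Finset.range (m + L + 1)) f ⟨0, by simp⟩
  have hmx : f m ≤ f x := hx m (Finset.mem_range.2 (by omega))
  have hmax : ∀ n, f n ≤ f x := fun n => by
    by_cases hn : n < m + L + 1
    · exact hx n (by simpa using hn)
    · have := hL n (by omega)
      omega
  have hex : ∃ n, f x ≤ f n := ⟨x, le_rfl⟩
  obtain ⟨a, ha⟩ : ∃ a, Nat.find hex = a + 1 := by
    refine Nat.exists_eq_succ_of_ne_zero fun h => ?_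
    have := Nat.find_spec hex
    rw [h] at this
    omega
  have ha1 : f x ≤ f (a + 1) := ha ▸ Nat.find_spec hex
  have ha2 : f a < f x := not_le.1 (Nat.find_min hex (m := a) (by omega))
  have hex' : ∃ n, a < n ∧ f (n + 1) < f x :=
    ⟨a + L + 1, by omega, by have := hL (a + L + 1 + 1) (by omega); omega⟩
  obtain ⟨hb1, hb2⟩ := Nat.find_spec hex'
  have key : ∀ n, a + 1 ≤ n → n ≤ Nat.find hex' → f x ≤ f n := by
    intro n hn
    induction n, hn using Nat.le_induction with
    | base => exact fun _ => ha1
    | succ n hn ih =>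
      intro hn'
      by_contra hlt
      exact Nat.find_min hex' (m := n) (by omega) ⟨by omega, by omega⟩
  refine ⟨a, Nat.find hex', hb1, by omega, ?_, fun n h1 h2 => hmx.trans (key n h1 h2)⟩
  exact hb2.trans_le (key _ hb1 le_rfl)

end PartialSums

/-- A symmetric exchange between two members of a tuple of elements of `B`. -/
def IsExchange {σ ι : Type*} (B : Set (σ →₀ ℕ)) (U U' : ι → B) : Prop :=
  ∃ (i j : ι) (ξ ρ : σ), (U j : σ →₀ ℕ) ξ < (U i : σ →₀ ℕ) ξ ∧
    (U i : σ →₀ ℕ) ρ < (U j : σ →₀ ℕ) ρ ∧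
    (U' i : σ →₀ ℕ) = (U i : σ →₀ ℕ) - Finsupp.single ξ 1 + Finsupp.single ρ 1 ∧
    (U' j : σ →₀ ℕ) = (U j : σ →₀ ℕ) - Finsupp.single ρ 1 + Finsupp.single ξ 1 ∧
    ∀ l, l ≠ i → l ≠ j → U' l = U l

theorem exists_isExchange {σ ι : Type*} {B : Set (σ →₀ ℕ)} {U : ι → B} {i j : ι} {ξ ρ : σ}
    (hξ : (U j : σ →₀ ℕ) ξ < (U i : σ →₀ ℕ) ξ) (hρ : (U i : σ →₀ ℕ) ρ < (U j : σ →₀ ℕ) ρ)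
    (hi : (U i : σ →₀ ℕ) - Finsupp.single ξ 1 + Finsupp.single ρ 1 ∈ B)
    (hj : (U j : σ →₀ ℕ) - Finsupp.single ρ 1 + Finsupp.single ξ 1 ∈ B) :
    ∃ U' : ι → B, IsExchange B U U' ∧
      (U' i : σ →₀ ℕ) + Finsupp.single ξ 1 = (U i : σ →₀ ℕ) + Finsupp.single ρ 1 ∧
      (U' j : σ →₀ ℕ) + Finsupp.single ρ 1 = (U j : σ →₀ ℕ) + Finsupp.single ξ 1 ∧
      ∀ l, l ≠ i → l ≠ j → U' l = U l := by
  classical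
  have hij : i ≠ j := by
    rintro rfl
    exact lt_irrefl _ hξ
  refine ⟨Function.update (Function.update U i ⟨_, hi⟩) j ⟨_, hj⟩,
    ⟨i, j, ξ, ρ, hξ, hρ, ?_, ?_, ?_⟩, ?_, ?_, ?_⟩
  · simp [hij]
  · simp
  · intro l h1 h2
    simp [h1, h2]
  · simpa [hij] using sub_single_add_single (by omega)
  · simpa using sub_single_add_single (by omega)
  · intro l h1 h2
    simp [h1, h2]

/-! ### Sorting tuples by symmetric exchanges -/

section Sorting

variable {V : Type*} [Fintype V] {N : ℕ}

/-- The `l`-th member of a tuple `U` contributes `N * initialSum k m (U l) + l` to the statistic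
which decides whether `U` is sorted. -/
def sortingValue (k : V → ℕ) (m : ℕ) (U : Fin N → V →₀ ℕ) (l : Fin N) : ℕ :=
  N * initialSum k m (U l) + l

/-- A tuple is sorted with respect to `k` if all its initial sums are as equal as possible, ties
being broken by the position in the tuple. -/
def IsSorted (k : V → ℕ) (U : Fin N → V →₀ ℕ) : Prop :=
  ∀ m i j, i ≠ j → sortingValue k m U i ≤ sortingValue k m U j + N

/-- The quantity which decreases when a tuple is sorted. -/
def potential (k : V → ℕ) (L : ℕ) (U : Fin N → V →₀ ℕ) : ℕ :=
  ∑ m ∈ Finset.range L, ∑ l, sortingValue k m U l ^ 2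

/-- The sum of squares drops by `2c(f i - f j - c)`, which is positive. -/
theorem sum_sq_lt_of_transfer {ι : Type*} [Fintype ι] {f g : ι → ℕ} {i j : ι} {c : ℕ}
    (hc : 0 < c) (hi : g i + c = f i) (hj : g j = f j + c) (hij : f j + c < f i)
    (h : ∀ l, l ≠ i → l ≠ j → g l = f l) : ∑ l, g l ^ 2 < ∑ l, f l ^ 2 := by
  classical
  have hne : i ≠ j := by
    rintro rfl
    omega
  have hd : ∑ l, ((f l : ℤ) ^ 2 - (g l : ℤ) ^ 2) =
      ((f i : ℤ) ^ 2 - (g i : ℤ) ^ 2) + ((f j : ℤ) ^ 2 - (g j : ℤ) ^ 2) :=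
    Fintype.sum_eq_add i j hne fun l hl => by rw [h l hl.1 hl.2, sub_self]
  rw [Finset.sum_sub_distrib] at hd
  zify at hi hj hij hc ⊢
  rw [← sub_pos, hd, hj, ← hi]
  rw [← hi] at hij
  nlinarith

/-- Only cuts `m` with `k ξ < m ≤ k ρ` separate `ξ` from `ρ`. At each of them the exchange moves `N`
from the sorting value of `i` to that of `j`, whose gap exceeds `N`. -/
theorem potential_lt {k : V → ℕ} {L : ℕ} {U U' : Fin N → V →₀ ℕ} {i j : Fin N} {ξ ρ : V}
    (hi : U' i + Finsupp.single ξ 1 = U i + Finsupp.single ρ 1)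
    (hj : U' j + Finsupp.single ρ 1 = U j + Finsupp.single ξ 1)
    (h : ∀ l, l ≠ i → l ≠ j → U' l = U l) (hlt : k ξ < k ρ) (hL : k ρ < L)
    (hm : ∀ m, k ξ < m → m ≤ k ρ → sortingValue k m U j + N < sortingValue k m U i) :
    potential k L U' < potential k L U := by
  have hN : 0 < N := i.pos
  have strict : ∀ m, k ξ < m → m ≤ k ρ →
      ∑ l, sortingValue k m U' l ^ 2 < ∑ l, sortingValue k m U l ^ 2 := by
    intro m h1 h2
    have e1 := initialSum_exchange hi k m
    have e2 := initialSum_exchange hj k m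
    rw [if_pos h1, if_neg (by omega)] at e1
    rw [if_neg (by omega), if_pos h1] at e2
    refine sum_sq_lt_of_transfer hN (i := i) (j := j) ?_ ?_ (hm m h1 h2) ?_
    · simp only [sortingValue]
      rw [add_zero] at e1
      rw [← e1]
      ring
    · simp only [sortingValue]
      rw [add_zero] at e2
      rw [e2]
      ring
    · intro l h3 h4
      rw [sortingValue, sortingValue, h l h3 h4]
  have same : ∀ m, ¬ (k ξ < m ∧ m ≤ k ρ) → ∀ l, sortingValue k m U' l = sortingValue k m U l := by
    intro m hm l
    rw [sortingValue, sortingValue]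
    congr 2
    by_cases h1 : l = i
    · subst h1
      have e1 := initialSum_exchange hi k m
      split_ifs at e1 <;> omega
    by_cases h2 : l = j
    · subst h2
      have e1 := initialSum_exchange hj k m
      split_ifs at e1 <;> omega
    rw [h l h1 h2]
  refine Finset.sum_lt_sum (fun m _ => ?_) ⟨k ρ, by simpa using hL, strict _ hlt le_rfl⟩
  by_cases h1 : k ξ < m ∧ m ≤ k ρ
  · exact (strict m h1.1 h1.2).le
  · simp only [same m h1, le_refl]

/-- If a tuple of vectors of equal degree is not sorted, then there are blocks between which an
exchange brings it closer to being sorted. -/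
theorem exists_peak_of_not_isSorted {k : V → ℕ} {U : Fin N → V →₀ ℕ}
    (hU : ∀ i j, (U i).degree = (U j).degree) (h : ¬ IsSorted k U) :
    ∃ i j, i ≠ j ∧ ∃ a b, a < b ∧ blockSum k a (U j) < blockSum k a (U i) ∧
      blockSum k b (U i) < blockSum k b (U j) ∧
      ∀ m, a < m → m ≤ b → sortingValue k m U j + N < sortingValue k m U i := by
  simp only [IsSorted, not_forall, not_le] at h
  obtain ⟨m, i, j, hij, hlt⟩ := h
  have hN : 0 < N := i.pos
  have hbig : ∀ n, sortingValue k n U j + N < sortingValue k n U i ↔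
      (N : ℤ) + j - i < N * ((initialSum k n (U i) : ℤ) - initialSum k n (U j)) := by
    intro n
    rw [sortingValue, sortingValue]
    zify
    constructor <;> intro <;> linarith
  obtain ⟨L, hL⟩ : ∃ L, ∀ x, k x < L :=
    ⟨Finset.univ.sup k + 1, fun x => Nat.lt_succ_of_le (Finset.le_sup (Finset.mem_univ x))⟩
  -- As `i < N`, the bound `N + j - i` is positive, so the tie-breaking terms cannot account for the
  -- gap alone.
  have hpos : 0 < (initialSum k m (U i) : ℤ) - initialSum k m (U j) := by
    have h1 := (hbig m).1 hlt
    have h2 := i.isLt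
    refine pos_of_mul_pos_right (a := (N : ℤ)) ?_ (by omega)
    omega
  obtain ⟨a, b, hab, ha, hb, hpeak⟩ := exists_peak
    (f := fun n => (initialSum k n (U i) : ℤ) - initialSum k n (U j)) (L := L)
    (by simp [initialSum_zero])
    (fun n hn => by
      rw [initialSum_eq_degree (fun x => (hL x).trans_le hn),
        initialSum_eq_degree (fun x => (hL x).trans_le hn), hU i j, sub_self]) hpos
  simp only [initialSum_add_one, Nat.cast_add] at ha hb
  refine ⟨i, j, hij, a, b, hab, by omega, by omega, fun n h1 h2 => (hbig n).2 ?_⟩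
  exact ((hbig m).1 hlt).trans_le (mul_le_mul_of_nonneg_left (hpeak n h1 h2) (by omega))

/-- The caps survive because each member gains a variable in a block where its sum is strictly below
that of the other member, hence below `c`. -/
theorem exists_exchange_of_not_isSorted_blocks {k : V → ℕ} {d c L : ℕ} (hL : ∀ x, k x < L)
    {U : Fin N → cappedBlocks k d c} (h : ¬ IsSorted k (fun l => (U l : V →₀ ℕ))) :
    ∃ U' : Fin N → cappedBlocks k d c, IsExchange _ U U' ∧
      potential k L (fun l => (U' l : V →₀ ℕ)) < potential k L (fun l => (U l : V →₀ ℕ)) := by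
  obtain ⟨i, j, hij, a, b, hab, ha, hb, hpeak⟩ := exists_peak_of_not_isSorted
    (fun i j => (U i).2.1.trans (U j).2.1.symm) h
  obtain ⟨ξ, hξ, hξ'⟩ := Finset.exists_lt_of_sum_lt ha
  obtain ⟨ρ, hρ, hρ'⟩ := Finset.exists_lt_of_sum_lt hb
  obtain rfl : k ξ = a := by simpa using hξ
  obtain rfl : k ρ = b := by simpa using hρ
  obtain ⟨U', hU', h1, h2, h3⟩ := exists_isExchange hξ' hρ'
    (cappedBlocks_of_exchange (U i).2 (sub_single_add_single (by omega))
      (Or.inr (hb.trans_le ((U j).2.2 _))))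
    (cappedBlocks_of_exchange (U j).2 (sub_single_add_single (by omega))
      (Or.inr (ha.trans_le ((U i).2.2 _))))
  exact ⟨U', hU', potential_lt h1 h2 (fun l h4 h5 => congrArg _ (h3 l h4 h5)) hab (hL ρ) hpeak⟩

/-- By `he`, `κ` refines `k`, the cut `p * e` of `κ` being the cut `p` of `k`. Being sorted for `k`
forces the exchanged variables into the same block, so neither the caps nor the `k`-initial sums are
affected. -/
theorem exists_exchange_of_not_isSorted {k κ : V → ℕ} {d c e L : ℕ}
    (hκ : ∀ x, κ x < L)
    (he : ∀ x p, κ x < p * e ↔ k x < p)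
    {U : Fin N → cappedBlocks k d c} (hk : IsSorted k (fun l => (U l : V →₀ ℕ)))
    (h : ¬ IsSorted κ (fun l => (U l : V →₀ ℕ))) :
    ∃ U' : Fin N → cappedBlocks k d c, IsExchange _ U U' ∧
      IsSorted k (fun l => (U' l : V →₀ ℕ)) ∧
      potential κ L (fun l => (U' l : V →₀ ℕ)) < potential κ L (fun l => (U l : V →₀ ℕ)) := by
  obtain ⟨i, j, hij, a, b, hab, ha, hb, hpeak⟩ := exists_peak_of_not_isSorted
    (fun i j => (U i).2.1.trans (U j).2.1.symm) h
  obtain ⟨ξ, hξ, hξ'⟩ := Finset.exists_lt_of_sum_lt ha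
  obtain ⟨ρ, hρ, hρ'⟩ := Finset.exists_lt_of_sum_lt hb
  obtain rfl : κ ξ = a := by simpa using hξ
  obtain rfl : κ ρ = b := by simpa using hρ
  have hboundary : ∀ p (a : V →₀ ℕ), initialSum κ (p * e) a = initialSum k p a := by
    intro p a
    simp only [initialSum, he]
  have hsame : k ξ = k ρ := by
    have h1 : κ ξ < (k ξ + 1) * e := (he _ _).2 (Nat.lt_succ_self _)
    have h2 : ¬ κ ξ < k ξ * e := fun h => lt_irrefl _ ((he _ _).1 h)
    have h3 : κ ρ < (k ρ + 1) * e := (he _ _).2 (Nat.lt_succ_self _)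
    rcases lt_trichotomy (k ξ) (k ρ) with hlt | heq | hlt
    -- Otherwise the block boundary `(k ξ + 1) * e` lies on the peak, and the large gap there
    -- contradicts sortedness for `k`.
    · have h4 : (k ξ + 1) * e ≤ κ ρ := by
        by_contra h5
        have := (he _ _).1 (not_le.1 h5)
        omega
      have h5 := hpeak _ h1 h4
      have h6 := hk (k ξ + 1) i j hij
      simp only [sortingValue, hboundary] at h5 h6
      omega
    · exact heq
    · have : (k ρ + 1) * e ≤ k ξ * e := Nat.mul_le_mul_right _ hlt
      omega
  obtain ⟨U', hU', h1, h2, h3⟩ := exists_isExchange hξ' hρ'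
    (cappedBlocks_of_exchange (U i).2 (sub_single_add_single (by omega)) (Or.inl hsame))
    (cappedBlocks_of_exchange (U j).2 (sub_single_add_single (by omega)) (Or.inl hsame.symm))
  refine ⟨U', hU', ?_,
    potential_lt h1 h2 (fun l h4 h5 => congrArg _ (h3 l h4 h5)) hab (hκ ρ) hpeak⟩
  have hinit : ∀ m l, initialSum k m (U' l : V →₀ ℕ) = initialSum k m (U l : V →₀ ℕ) := by
    intro m l
    by_cases h4 : l = i
    · subst h4
      simpa [hsame] using initialSum_exchange h1 k m
    by_cases h5 : l = j
    · subst h5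
      simpa [hsame] using initialSum_exchange h2 k m
    rw [h3 l h4 h5]
  simpa only [IsSorted, sortingValue, hinit] using hk

theorem exists_reflTransGen_of_potential {α : Type*} {r : α → α → Prop} {S T : α → Prop}
    (φ : α → ℕ) (step : ∀ u, S u → ¬ T u → ∃ v, r u v ∧ S v ∧ φ v < φ u) (u : α) (hu : S u) :
    ∃ v, Relation.ReflTransGen r u v ∧ S v ∧ T v := by
  induction hn : φ u using Nat.strong_induction_on generalizing u with
  | _ n ih =>
    by_cases hT : T u
    · exact ⟨u, .refl, hu, hT⟩
    · obtain ⟨v, hr, hS, hlt⟩ := step u hu hT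
      obtain ⟨w, hw, h⟩ := ih _ (hn ▸ hlt) v hS rfl
      exact ⟨w, .head hr hw, h⟩

theorem IsExchange.sum_eq {σ ι : Type*} [Fintype ι] {B : Set (σ →₀ ℕ)} {U U' : ι → B}
    (h : IsExchange B U U') : ∑ l, (U' l : σ →₀ ℕ) = ∑ l, (U l : σ →₀ ℕ) := by
  classical
  obtain ⟨i, j, ξ, ρ, hξ, hρ, hi, hj, h⟩ := h
  have hij : j ≠ i := by
    rintro rfl
    exact lt_irrefl _ hξ
  have hj' : j ∈ Finset.univ.erase i := by simp [hij]
  rw [← Finset.add_sum_erase _ _ (Finset.mem_univ i), ← Finset.add_sum_erase _ _ hj',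
    ← Finset.add_sum_erase _ (fun l => (U l : σ →₀ ℕ)) (Finset.mem_univ i),
    ← Finset.add_sum_erase _ (fun l => (U l : σ →₀ ℕ)) hj', ← add_assoc, ← add_assoc]
  congr 1
  · have e1 := sub_single_add_single (a := (U i : σ →₀ ℕ)) (ξ := ξ) (ρ := ρ) (by omega)
    have e2 := sub_single_add_single (a := (U j : σ →₀ ℕ)) (ξ := ρ) (ρ := ξ) (by omega)
    rw [← hi] at e1
    rw [← hj] at e2
    refine add_right_cancel (b := Finsupp.single ξ 1 + Finsupp.single ρ 1) ?_
    rw [add_add_add_comm, e1, e2]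
    abel
  · refine Finset.sum_congr rfl fun l hl => ?_
    simp only [Finset.mem_erase, Finset.mem_univ, and_true] at hl
    rw [h l hl.2 hl.1]

/-- The hypotheses make `f` and `g` nonincreasing with total variation at most one. If `f l < g l`,
then `f i ≤ f l + 1 ≤ g l ≤ g i` for `i < l` and `f i ≤ f l ≤ g l - 1 ≤ g i` for `i > l`, so the
sums differ. -/
theorem eq_of_sorted_of_sum_eq {f g : Fin N → ℕ}
    (hf : ∀ i j, i ≠ j → N * f i + i ≤ N * f j + j + N)
    (hg : ∀ i j, i ≠ j → N * g i + i ≤ N * g j + j + N) (h : ∑ i, f i = ∑ i, g i) : f = g := by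
  have mono : ∀ {f : Fin N → ℕ}, (∀ i j, i ≠ j → N * f i + i ≤ N * f j + j + N) →
      ∀ i j, i < j → f j ≤ f i ∧ f i ≤ f j + 1 := by
    intro f hf i j hij
    have h1 := hf i j hij.ne
    have h2 := hf j i hij.ne'
    have h3 : (i : ℕ) < j := hij
    have h4 := j.isLt
    constructor
    · by_contra hlt
      have := Nat.mul_le_mul_left N (Nat.succ_le_of_lt (not_le.1 hlt))
      rw [Nat.mul_succ] at this
      omega
    · by_contra hlt
      have := Nat.mul_le_mul_left N (Nat.succ_le_of_lt (not_le.1 hlt))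
      rw [Nat.mul_succ, Nat.mul_succ] at this
      omega
  have key : ∀ {f g : Fin N → ℕ}, (∀ i j, i ≠ j → N * f i + i ≤ N * f j + j + N) →
      (∀ i j, i ≠ j → N * g i + i ≤ N * g j + j + N) → ∑ i, f i = ∑ i, g i →
      ∀ l, ¬ f l < g l := by
    intro f g hf hg h l hl
    refine h.not_lt (Finset.sum_lt_sum (fun i _ => ?_) ⟨l, Finset.mem_univ l, hl⟩)
    rcases lt_trichotomy i l with hi | rfl | hi
    · have := mono hf _ _ hi
      have := mono hg _ _ hi
      omega
    · exact hl.le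
    · have := mono hf _ _ hi
      have := mono hg _ _ hi
      omega
  funext l
  exact le_antisymm (not_lt.1 (key hg hf h.symm l)) (not_lt.1 (key hf hg h l))

theorem IsSorted.eq_of_sum_eq {κ : V → ℕ} (hκ : Function.Injective κ) {U W : Fin N → V →₀ ℕ}
    (hU : IsSorted κ U) (hW : IsSorted κ W) (h : ∑ l, U l = ∑ l, W l) : U = W := by
  have hinit : ∀ m, (fun l => initialSum κ m (U l)) = fun l => initialSum κ m (W l) := fun m =>
    eq_of_sorted_of_sum_eq (hU m) (hW m) (by rw [← initialSum_sum, ← initialSum_sum, h])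
  funext l
  ext x
  have h1 := congrFun (hinit (κ x)) l
  have h2 := congrFun (hinit (κ x + 1)) l
  simp only [initialSum_add_one, blockSum_of_injective hκ] at h1 h2
  omega

/-- Two tuples of elements of `cappedBlocks k d c` with the same sum are connected by symmetric
exchanges: both can be turned into the same sorted tuple. -/
theorem exists_common_reduct {k : V → ℕ} {d c : ℕ} {U W : Fin N → cappedBlocks k d c}
    (h : ∑ l, (U l : V →₀ ℕ) = ∑ l, (W l : V →₀ ℕ)) :
    ∃ T, Relation.ReflTransGen (IsExchange _) U T ∧ Relation.ReflTransGen (IsExchange _) W T := by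
  set e := Fintype.card V
  -- An injective key listing the variables block by block: the index of `x` is less than `e`, so
  -- distinct blocks occupy disjoint intervals.
  set κ : V → ℕ := fun x => k x * e + Fintype.equivFin V x with hκ
  have he : ∀ x p, κ x < p * e ↔ k x < p := by
    intro x p
    have h1 : (Fintype.equivFin V x : ℕ) < e := (Fintype.equivFin V x).isLt
    constructor
    · intro h2
      by_contra h3
      have := Nat.mul_le_mul_right e (not_lt.1 h3)
      simp only [hκ] at h2
      omega
    · intro h2
      have := Nat.mul_le_mul_right e (Nat.succ_le_of_lt h2)
      rw [Nat.succ_mul] at this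
      simp only [hκ]
      omega
  have hinj : Function.Injective κ := by
    intro x y hxy
    have hk : k x = k y := by
      refine le_antisymm ?_ ?_
      · exact Nat.le_of_lt_succ ((he _ _).1 (hxy ▸ (he _ _).2 (Nat.lt_succ_self _)))
      · exact Nat.le_of_lt_succ ((he _ _).1 (hxy ▸ (he _ _).2 (Nat.lt_succ_self _)))
    simp only [hκ, hk, add_right_inj] at hxy
    exact (Fintype.equivFin V).injective (Fin.ext hxy)
  have hbound : ∀ f : V → ℕ, ∃ L, ∀ x, f x < L := fun f =>
    ⟨Finset.univ.sup f + 1, fun x => Nat.lt_succ_of_le (Finset.le_sup (Finset.mem_univ x))⟩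
  obtain ⟨L, hL⟩ := hbound k
  obtain ⟨L', hL'⟩ := hbound κ
  have sort : ∀ U : Fin N → cappedBlocks k d c, ∃ T, Relation.ReflTransGen (IsExchange _) U T ∧
      IsSorted κ (fun l => (T l : V →₀ ℕ)) := by
    intro U
    obtain ⟨T, hT, -, hTs⟩ := exists_reflTransGen_of_potential (r := IsExchange _)
      (S := fun _ => True) (T := fun U : Fin N → cappedBlocks k d c =>
        IsSorted k (fun l => (U l : V →₀ ℕ))) (fun U => potential k L (fun l => (U l : V →₀ ℕ)))
      (fun U _ hU => by simpa using exists_exchange_of_not_isSorted_blocks hL hU) U trivial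
    obtain ⟨T', hT', -, hTs'⟩ := exists_reflTransGen_of_potential (r := IsExchange _)
      (T := fun U : Fin N → cappedBlocks k d c => IsSorted κ (fun l => (U l : V →₀ ℕ)))
      (fun U => potential κ L' (fun l => (U l : V →₀ ℕ)))
      (fun U hU hU' => exists_exchange_of_not_isSorted hL' he hU hU') T hTs
    exact ⟨T', hT.trans hT', hTs'⟩
  have sum_eq : ∀ {U T : Fin N → cappedBlocks k d c}, Relation.ReflTransGen (IsExchange _) U T →
      ∑ l, (T l : V →₀ ℕ) = ∑ l, (U l : V →₀ ℕ) := by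
    intro U T hUT
    induction hUT with
    | refl => rfl
    | tail _ h ih => rw [h.sum_eq, ih]
  obtain ⟨T, hUT, hT⟩ := sort U
  obtain ⟨T', hWT, hT'⟩ := sort W
  have hTT : T = T' := by
    have := hT.eq_of_sum_eq hinj hT' (by rw [sum_eq hUT, sum_eq hWT, h])
    funext l
    exact Subtype.ext (congrFun this l)
  exact ⟨T, hUT, hTT ▸ hWT⟩

end Sorting

/-! ### From connectivity by exchanges to generators of the toric ideal -/

section ToricIdeal

variable {σ : Type*} {B : Set (σ →₀ ℕ)}

theorem exists_eq_sum_single {α : Type*} (a : α →₀ ℕ) :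
    ∃ (N : ℕ) (U : Fin N → α), a = ∑ l, Finsupp.single (U l) 1 := by
  induction a using Finsupp.induction_linear with
  | zero => exact ⟨0, Fin.elim0, by simp⟩
  | add a b ha hb =>
    obtain ⟨N, U, rfl⟩ := ha
    obtain ⟨M, W, rfl⟩ := hb
    exact ⟨N + M, Fin.append U W, by simp [Fin.sum_univ_add]⟩
  | single w n => exact ⟨n, fun _ => w, by simp⟩

/-- The exponent vector of the image of a monomial `z ^ α` under the map `z_w ↦ w`. -/
noncomputable def toricExponent (B : Set (σ →₀ ℕ)) : (B →₀ ℕ) →ₗ[ℕ] (σ →₀ ℕ) :=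
  Finsupp.linearCombination ℕ Subtype.val

theorem toricExponent_sum_single {ι : Type*} [Fintype ι] (U : ι → B) :
    toricExponent B (∑ l, Finsupp.single (U l) 1) = ∑ l, (U l : σ →₀ ℕ) := by
  simp [toricExponent]

theorem aeval_monomial_eq (K : Type*) [Field K] (α : B →₀ ℕ) :
    aeval (fun w : B => monomial (w : σ →₀ ℕ) (1 : K)) (monomial α (1 : K)) =
      monomial (toricExponent B α) (1 : K) := by
  obtain ⟨N, U, rfl⟩ := exists_eq_sum_single α
  rw [toricExponent_sum_single, monomial_sum_one, monomial_sum_one, map_prod]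
  exact Finset.prod_congr rfl fun l _ => aeval_X _ _

theorem symmetricExchangeBinomials_subset (K : Type*) [Field K] :
    symmetricExchangeBinomials K B ⊆ toricIdeal K B := by
  rintro _ ⟨a, b, a', b', ξ, ρ, hξ, hρ, ha, hb, rfl⟩
  have e1 := sub_single_add_single (a := (a : σ →₀ ℕ)) (ξ := ξ) (ρ := ρ) (by omega)
  have e2 := sub_single_add_single (a := (b : σ →₀ ℕ)) (ξ := ρ) (ρ := ξ) (by omega)
  rw [← ha] at e1
  rw [← hb] at e2
  have h : (a : σ →₀ ℕ) + b = a' + b' := by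
    refine add_right_cancel (b := Finsupp.single ρ 1 + Finsupp.single ξ 1) ?_
    rw [add_add_add_comm, ← e1, ← e2]
    abel
  rw [SetLike.mem_coe, toricIdeal, RingHom.mem_ker]
  simp [monomial_mul, h]

theorem IsExchange.mk_prod_eq (K : Type*) [Field K] {ι : Type*} [Fintype ι] {U U' : ι → B}
    (h : IsExchange B U U') :
    Ideal.Quotient.mk (Ideal.span (symmetricExchangeBinomials K B)) (∏ l, X (U l)) =
      Ideal.Quotient.mk (Ideal.span (symmetricExchangeBinomials K B)) (∏ l, X (U' l)) := by
  classical
  obtain ⟨i, j, ξ, ρ, hξ, hρ, hi, hj, h⟩ := h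
  have hij : j ≠ i := by
    rintro rfl
    exact lt_irrefl _ hξ
  have hj' : j ∈ Finset.univ.erase i := by simp [hij]
  rw [← Finset.mul_prod_erase _ _ (Finset.mem_univ i), ← Finset.mul_prod_erase _ _ hj',
    ← Finset.mul_prod_erase _ (fun l => X (U' l)) (Finset.mem_univ i),
    ← Finset.mul_prod_erase _ (fun l => X (U' l)) hj', ← mul_assoc, ← mul_assoc, map_mul,
    map_mul _ (X (U' i) * X (U' j))]
  congr 1
  · exact Ideal.Quotient.eq.2 (Ideal.subset_span ⟨_, _, _, _, ξ, ρ, hξ, hρ, hi, hj, rfl⟩)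
  · refine congrArg _ (Finset.prod_congr rfl fun l hl => ?_)
    simp only [Finset.mem_erase, Finset.mem_univ, and_true] at hl
    rw [h l hl.2 hl.1]

theorem mk_monomial_eq (K : Type*) [Field K] {d : ℕ} (hd : 0 < d) (hB : ∀ a ∈ B, a.degree = d)
    (hconn : ∀ (N : ℕ) (U W : Fin N → B), ∑ l, (U l : σ →₀ ℕ) = ∑ l, (W l : σ →₀ ℕ) →
      ∃ T, Relation.ReflTransGen (IsExchange B) U T ∧ Relation.ReflTransGen (IsExchange B) W T)
    {α β : B →₀ ℕ} (h : toricExponent B α = toricExponent B β) :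
    Ideal.Quotient.mk (Ideal.span (symmetricExchangeBinomials K B)) (monomial α 1) =
      Ideal.Quotient.mk (Ideal.span (symmetricExchangeBinomials K B)) (monomial β 1) := by
  have hprod : ∀ {N : ℕ} {U T : Fin N → B}, Relation.ReflTransGen (IsExchange B) U T →
      Ideal.Quotient.mk (Ideal.span (symmetricExchangeBinomials K B)) (∏ l, X (U l)) =
      Ideal.Quotient.mk (Ideal.span (symmetricExchangeBinomials K B)) (∏ l, X (T l)) := by
    intro N U T hUT
    induction hUT with
    | refl => rfl
    | tail _ h ih => rw [ih, h.mk_prod_eq K]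
  obtain ⟨N, U, rfl⟩ := exists_eq_sum_single α
  obtain ⟨M, W, rfl⟩ := exists_eq_sum_single β
  rw [toricExponent_sum_single, toricExponent_sum_single] at h
  -- Equal products have equal degree, and every factor has the same positive degree `d`.
  obtain rfl : N = M := by
    have hdeg := congrArg Finsupp.degree h
    simp only [map_sum, fun l => hB _ (U l).2, fun l => hB _ (W l).2, Finset.sum_const,
      Finset.card_univ, Fintype.card_fin, smul_eq_mul] at hdeg
    exact Nat.eq_of_mul_eq_mul_right hd hdeg
  obtain ⟨T, hU, hW⟩ := hconn N U W h
  rw [monomial_sum_one, monomial_sum_one]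
  exact (hprod hU).trans (hprod hW).symm

/-- If any two tuples of elements of `B` with the same sum are connected by symmetric exchanges,
then the toric ideal of `B` is generated by the symmetric exchange binomials. -/
theorem span_symmetricExchangeBinomials_eq (K : Type*) [Field K] {d : ℕ} (hd : 0 < d)
    (hB : ∀ a ∈ B, a.degree = d)
    (hconn : ∀ (N : ℕ) (U W : Fin N → B), ∑ l, (U l : σ →₀ ℕ) = ∑ l, (W l : σ →₀ ℕ) →
      ∃ T, Relation.ReflTransGen (IsExchange B) U T ∧ Relation.ReflTransGen (IsExchange B) W T) :
    Ideal.span (symmetricExchangeBinomials K B) = toricIdeal K B := by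
  refine le_antisymm (Ideal.span_le.2 (symmetricExchangeBinomials_subset K)) fun f hf => ?_
  set J := Ideal.span (symmetricExchangeBinomials K B)
  have hfac : Function.FactorsThrough (fun α : B →₀ ℕ => Ideal.Quotient.mk J (monomial α 1))
      (toricExponent B) := fun α β h => mk_monomial_eq K hd hB hconn h
  -- A linear map sending the image of `z ^ α` to the class of `z ^ α`, well defined by `hfac`, and
  -- every monomial outside the image to `0`. Since `ψ` after the toric map is the quotient map, the
  -- toric kernel lies in `J`.
  let ψ : MvPolynomial σ K →ₗ[K] MvPolynomial B K ⧸ J := (basisMonomials σ K).constr K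
    (Function.extend (toricExponent B)
      (fun α : B →₀ ℕ => Ideal.Quotient.mk J (monomial α 1)) 0)
  have hψ : ψ ∘ₗ (aeval (fun w : B => monomial (w : σ →₀ ℕ) (1 : K))).toLinearMap =
      (Ideal.Quotient.mkₐ K J).toLinearMap := by
    refine (basisMonomials B K).ext fun α => ?_
    have h1 : ψ (monomial (toricExponent B α) 1) = Ideal.Quotient.mk J (monomial α 1) := by
      have h := (basisMonomials σ K).constr_basis K (Function.extend (toricExponent B)
        (fun α : B →₀ ℕ => Ideal.Quotient.mk J (monomial α 1)) 0) (toricExponent B α)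
      rw [hfac.extend_apply 0 α, coe_basisMonomials] at h
      exact h
    rw [← aeval_monomial_eq] at h1
    rw [coe_basisMonomials]
    exact h1
  have h2 := LinearMap.congr_fun hψ f
  rw [toricIdeal, RingHom.mem_ker] at hf
  refine Ideal.Quotient.eq_zero_iff_mem.1 (h2.symm.trans ?_)
  exact (congrArg ψ hf).trans (map_zero ψ)

end ToricIdeal

/-! ### Powers of edge ideals and complete multipartite graphs -/

section EdgeIdeal

open scoped Pointwise

/-- The exponent vectors of the monomials `x_v x_w` with `{v, w}` an edge of `G`. -/
def edgeVectors {V : Type*} (G : SimpleGraph V) : Set (V →₀ ℕ) :=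
  {a | ∃ v w : V, G.Adj v w ∧ a = Finsupp.single v 1 + Finsupp.single w 1}

theorem edgeIdeal_pow_eq (K : Type*) [Field K] {V : Type*} (G : SimpleGraph V) (q : ℕ) :
    Ideal.span ((fun a => monomial a (1 : K)) '' (q • edgeVectors G)) = edgeIdeal K G ^ q := by
  induction q with
  | zero => simp
  | succ q ih =>
    have h : edgeIdeal K G = Ideal.span ((fun a => monomial a (1 : K)) '' edgeVectors G) := by
      rw [edgeIdeal]
      congr 1
      ext f
      constructor
      · rintro ⟨v, w, hvw, rfl⟩
        exact ⟨_, ⟨v, w, hvw, rfl⟩, by simp [X, monomial_mul]⟩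
      · rintro ⟨_, ⟨v, w, hvw, rfl⟩, rfl⟩
        exact ⟨v, w, hvw, by simp [X, monomial_mul]⟩
    rw [pow_succ, ← ih, h, Ideal.span_mul_span', succ_nsmul]
    congr 1
    ext f
    simp [Set.mem_mul, Set.mem_add, monomial_mul]

theorem degree_of_mem_nsmul {V : Type*} {G : SimpleGraph V} {q : ℕ} {a : V →₀ ℕ}
    (ha : a ∈ q • edgeVectors G) : a.degree = 2 * q := by
  induction q generalizing a with
  | zero =>
    rw [zero_nsmul, Set.mem_zero] at ha
    simp [ha]
  | succ q ih =>
    rw [succ_nsmul, Set.mem_add] at ha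
    obtain ⟨b, hb, _, ⟨v, w, -, rfl⟩, rfl⟩ := ha
    simp [ih hb]
    ring

/-- The generating products of `q` edges all have degree `2 * q`, so none properly divides another.
-/
theorem minimalGenerators_edgeIdeal_pow (K : Type*) [Field K] {V : Type*} (G : SimpleGraph V)
    (q : ℕ) : minimalGenerators (edgeIdeal K G ^ q) = q • edgeVectors G := by
  classical
  refine (minimalGenerators_subset _ _ (edgeIdeal_pow_eq K G q)).antisymm fun a ha => ?_
  change Minimal (fun b : V →₀ ℕ => monomial b (1 : K) ∈ edgeIdeal K G ^ q) a
  refine ⟨?_, fun b hb hba => ?_⟩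
  · rw [← edgeIdeal_pow_eq]
    exact Ideal.subset_span ⟨a, ha, rfl⟩
  · rw [← edgeIdeal_pow_eq] at hb
    obtain ⟨s, hs, hsb⟩ := mem_ideal_span_monomial_image.1 hb b (by simp [mem_support_iff])
    obtain ⟨c, rfl⟩ := exists_add_of_le (hsb.trans hba)
    have h := degree_of_mem_nsmul ha
    rw [map_add, degree_of_mem_nsmul hs, add_eq_left, Finsupp.degree_eq_zero_iff] at h
    rw [h, add_zero]
    exact hsb

theorem isCompleteMultipartite_of_isPolymatroid {V : Type*} [Finite V] {G : SimpleGraph V}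
    (hG : ∀ v : V, ∃ w : V, G.Adj v w) {q : ℕ} (hq : 1 ≤ q)
    (h : IsPolymatroid (q • edgeVectors G)) : G.IsCompleteMultipartite := by
  classical
  have := Fintype.ofFinite V
  refine ⟨fun x y z hxy hyz hxz => ?_⟩
  obtain ⟨w, hyw⟩ := hG y
  have hwx : w ≠ x := by
    rintro rfl
    exact hxy hyw.symm
  have hwz : w ≠ z := by
    rintro rfl
    exact hyz hyw
  have hyx : y ≠ x := by
    rintro rfl
    exact hyz hxz
  have hyz' : y ≠ z := by
    rintro rfl
    exact hxy hxz
  have hmem : ∀ {v w : V}, G.Adj v w →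
      q • (Finsupp.single v 1 + Finsupp.single w 1) ∈ q • edgeVectors G := fun {v w} hvw =>
    Set.nsmul_mem_nsmul ⟨v, w, hvw, rfl⟩
  -- Each edge containing `y` contributes its other endpoint, a neighbour of `y`.
  have hneighbors : ∀ (n : ℕ) (c : V →₀ ℕ), c ∈ n • edgeVectors G →
      c y ≤ ∑ v with G.Adj y v, c v := by
    intro n
    induction n with
    | zero =>
      intro c hc
      rw [zero_nsmul, Set.mem_zero] at hc
      simp [hc]
    | succ n ih =>
      intro c hc
      rw [succ_nsmul, Set.mem_add] at hc
      obtain ⟨b, hb, _, ⟨v, w, hvw, rfl⟩, rfl⟩ := hc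
      have h1 := ih b hb
      have h2 : (if v = y then 1 else 0) + (if w = y then 1 else 0) ≤
          (if G.Adj y v then 1 else 0) + (if G.Adj y w then 1 else 0) := by
        by_cases hv : v = y
        · subst hv
          simp [hvw, hvw.ne']
        · by_cases hw : w = y
          · subst hw
            simp [hvw.symm, hv]
          · simp [hv, hw]
      simp only [Finsupp.add_apply, Finset.sum_add_distrib]
      refine add_le_add h1 ?_
      simpa [Finsupp.single_apply] using h2
  -- Exchange `w` out of `(yw)^q` against `(xz)^q`. The incoming variable is `x` or `z`, not a
  -- neighbour of `y`, so `hneighbors` fails for the result.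
  obtain ⟨ρ, hρ, hmemρ⟩ := h.2.2 _ (hmem hyw) _ (hmem hxz) w (by
    simp [hwx.symm, hwz.symm, hyw.ne]
    omega)
  have hρ' : ρ = x ∨ ρ = z := by
    by_contra hne
    push Not at hne
    simp [Finsupp.single_apply, hne.1.symm, hne.2.symm] at hρ
  have hyρ : ¬ G.Adj y ρ := by
    rcases hρ' with rfl | rfl
    · exact fun h => hxy h.symm
    · exact hyz
  have hρy : ρ ≠ y := by
    rcases hρ' with rfl | rfl
    · exact hyx.symm
    · exact hyz'.symm
  have h1 := hneighbors _ _ hmemρ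
  have h2 := sum_finset_exchange (sub_single_add_single (a := q • (Finsupp.single y 1 +
    Finsupp.single w 1)) (ξ := w) (ρ := ρ) (by simp; omega)) (fun v => G.Adj y v)
  have h3 : ∑ v with G.Adj y v, (q • (Finsupp.single y 1 + Finsupp.single w 1) : V →₀ ℕ) v = q := by
    simp [Finset.sum_add_distrib, Finsupp.single_apply, hyw]
  rw [if_pos hyw, if_neg hyρ, h3] at h2
  have h4 : (q • (Finsupp.single y 1 + Finsupp.single w 1) - Finsupp.single w 1 +
      Finsupp.single ρ 1 : V →₀ ℕ) y = q := by
    simp [hyw.ne', hρy]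
  omega

theorem sum_blockSum_le {V : Type*} [Fintype V] {k : V → ℕ} (s : Finset ℕ) (a : V →₀ ℕ) :
    ∑ p ∈ s, blockSum k p a ≤ a.degree := by
  classical
  simp only [blockSum, Finsupp.degree_eq_sum, Finset.sum_filter]
  rw [Finset.sum_comm]
  refine Finset.sum_le_sum fun x _ => ?_
  rw [Finset.sum_ite_eq]
  split_ifs <;> simp

theorem exists_pos_of_blockSum_pos {V : Type*} [Fintype V] {k : V → ℕ} {p : ℕ} {a : V →₀ ℕ}
    (h : 0 < blockSum k p a) : ∃ x, k x = p ∧ 0 < a x := by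
  by_contra! hne
  refine h.ne' (Finset.sum_eq_zero fun x hx => ?_)
  have := hne x (by simpa using hx)
  omega

/-- An edge meets each block at most once, whence the caps. Conversely, split off an edge joining
the heaviest block to the heaviest remaining one; the quotient satisfies the caps for `q - 1`. -/
theorem nsmul_edgeVectors_eq_cappedBlocks {V : Type*} [Fintype V] {G : SimpleGraph V} {k : V → ℕ}
    (hk : ∀ x y, G.Adj x y ↔ k x ≠ k y) (q : ℕ) :
    q • edgeVectors G = cappedBlocks k (2 * q) q := by
  classical
  refine Set.Subset.antisymm (fun a ha => ⟨degree_of_mem_nsmul ha, fun p => ?_⟩) ?_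
  · induction q generalizing a with
    | zero =>
      rw [zero_nsmul, Set.mem_zero] at ha
      simp [ha, blockSum]
    | succ q ih =>
      rw [succ_nsmul, Set.mem_add] at ha
      obtain ⟨b, hb, _, ⟨v, w, hvw, rfl⟩, rfl⟩ := ha
      have h1 := ih b hb
      have h2 := (hk v w).1 hvw
      have h3 : blockSum k p (b + (Finsupp.single v 1 + Finsupp.single w 1)) = blockSum k p b +
          ((if k v = p then 1 else 0) + (if k w = p then 1 else 0)) := by
        simp [blockSum, Finset.sum_add_distrib, Finsupp.single_apply]
      rw [h3]
      split_ifs <;> omega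
  · induction q with
    | zero =>
      rintro a ⟨ha, -⟩
      rw [mul_zero, Finsupp.degree_eq_zero_iff] at ha
      simp [ha]
    | succ q ih =>
      rintro a ⟨ha, hcap⟩
      have hne : a.support.Nonempty := by
        rw [Finsupp.support_nonempty_iff]
        rintro rfl
        simp at ha
      obtain ⟨x, hx, hxmax⟩ := Finset.exists_max_image a.support (fun x => blockSum k (k x) a) hne
      -- If one block carried the whole degree `2 * (q + 1)`, it would exceed its cap `q + 1`.
      have hne' : (a.support.filter fun y => k y ≠ k x).Nonempty := by
        by_contra hempty
        have h1 : a.degree = blockSum k (k x) a := by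
          rw [blockSum, Finsupp.degree_eq_sum, Finset.sum_filter]
          refine Finset.sum_congr rfl fun y _ => ?_
          split_ifs with hy
          · rfl
          · by_contra hy'
            exact hempty ⟨y, by simp [hy, hy']⟩
        have := hcap (k x)
        omega
      obtain ⟨y, hy, hymax⟩ := Finset.exists_max_image _ (fun y => blockSum k (k y) a) hne'
      simp only [Finset.mem_filter] at hy hymax
      obtain ⟨b, hb⟩ : ∃ b, a = b + (Finsupp.single x 1 + Finsupp.single y 1) := by
        suffices hle : Finsupp.single x 1 + Finsupp.single y 1 ≤ a from
          ⟨_, (tsub_add_cancel_of_le hle).symm⟩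
        intro z
        have h1 := Finsupp.mem_support_iff.1 hx
        have h2 := Finsupp.mem_support_iff.1 hy.1
        have h3 : x ≠ y := fun h => hy.2 (h ▸ rfl)
        simp only [Finsupp.add_apply, Finsupp.single_apply]
        split_ifs with h4 h5 h5
        · exact absurd (h4.trans h5.symm) h3
        · subst h4
          omega
        · subst h5
          omega
        · omega
      have hblock : ∀ p, blockSum k p a = blockSum k p b +
          ((if k x = p then 1 else 0) + (if k y = p then 1 else 0)) := by
        intro p
        rw [hb]
        simp [blockSum, Finset.sum_add_distrib, Finsupp.single_apply]
      rw [hb, succ_nsmul]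
      refine Set.add_mem_add (ih ⟨?_, fun p => ?_⟩) ⟨x, y, (hk x y).2 hy.2.symm, rfl⟩
      · have := congrArg Finsupp.degree hb
        simp only [map_add, Finsupp.degree_single] at this
        omega
      · have h1 := hblock p
        have h2 := hcap p
        by_cases hpx : k x = p
        · rw [if_pos hpx] at h1
          omega
        by_cases hpy : k y = p
        · rw [if_pos hpy] at h1
          omega
        rw [if_neg hpx, if_neg hpy] at h1
        -- Otherwise a third block has sum at least `q + 1`, and so do the two at least as heavy
        -- blocks of `x` and `y`, exceeding the degree `2 * (q + 1)`.
        by_contra hlt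
        obtain ⟨z, rfl, hz⟩ := exists_pos_of_blockSum_pos (k := k) (p := p) (a := a) (by omega)
        have hz' : z ∈ a.support := Finsupp.mem_support_iff.2 hz.ne'
        have h3 := hxmax z hz'
        have h4 := hymax z ⟨hz', fun h => hpx h.symm⟩
        have h5 := sum_blockSum_le (k := k) {k x, k y, k z} a
        rw [Finset.sum_insert (by simp [hpx, hy.2.symm]), Finset.sum_insert (by simp [hpy]),
          Finset.sum_singleton] at h5
        omega

theorem isPolymatroid_cappedBlocks {V : Type*} [Fintype V] (k : V → ℕ) (q : ℕ) :
    IsPolymatroid (cappedBlocks k (2 * q) q) := by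
  classical
  refine ⟨(Finsupp.finite_of_degree_eq (2 * q)).subset fun a ha => ha.1,
    fun a ha b hb => ha.1.trans hb.1.symm, fun a ha b hb ξ hξ => ?_⟩
  have hex : ∀ ρ, a ρ < b ρ → (k ξ = k ρ ∨ blockSum k (k ρ) a < q) →
      ∃ ρ, a ρ < b ρ ∧ a - Finsupp.single ξ 1 + Finsupp.single ρ 1 ∈
        cappedBlocks k (2 * q) q := fun ρ h1 h2 =>
    ⟨ρ, h1, cappedBlocks_of_exchange ha (sub_single_add_single (by omega)) h2⟩
  have hpos : 0 < blockSum k (k ξ) a :=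
    lt_of_lt_of_le (by omega : 0 < a ξ) (Finset.single_le_sum (f := fun x => a x)
      (fun _ _ => Nat.zero_le _) (by simp))
  have hsum : ∀ (c : V →₀ ℕ) (p : ℕ), blockSum k p c + ∑ x with ¬ k x = p, c x = c.degree :=
    fun c p => by
      rw [blockSum, Finsupp.degree_eq_sum, Finset.sum_filter_add_sum_filter_not]
  -- The only obstacle is a full block `p` other than that of `ξ`. Then `a` has degree `q` outside
  -- `p` and `b` at least `q`, so some `ρ` outside `p` can be chosen. Its block is that of `ξ` or
  -- has room, since `p` and the block of `ξ` already use more than `q` of the degree `2 * q`.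
  by_cases hfull : ∃ p, p ≠ k ξ ∧ blockSum k p a = q
  · obtain ⟨p, hp, hpa⟩ := hfull
    have h1 := hsum a p
    have h2 := hsum b p
    rw [ha.1] at h1
    rw [hb.1] at h2
    have h3 := hb.2 p
    obtain ⟨ρ, hρ, hρ'⟩ : ∃ ρ, k ρ ≠ p ∧ a ρ < b ρ := by
      by_contra! hle
      have : ∑ x with ¬ k x = p, b x < ∑ x with ¬ k x = p, a x :=
        Finset.sum_lt_sum (fun x hx => hle x (by simpa using hx)) ⟨ξ, by simpa using hp.symm, hξ⟩
      omega
    refine hex ρ hρ' (or_iff_not_imp_left.2 fun hne => ?_)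
    have h5 := sum_blockSum_le (k := k) {p, k ξ, k ρ} a
    rw [Finset.sum_insert (by simp [hp, hρ.symm]), Finset.sum_insert (by simp [hne]),
      Finset.sum_singleton, ha.1] at h5
    omega
  · push Not at hfull
    obtain ⟨ρ, hρ⟩ : ∃ ρ, a ρ < b ρ := by
      by_contra! hle
      have h1 : ∑ x, b x < ∑ x, a x :=
        Finset.sum_lt_sum (fun x _ => hle x) ⟨ξ, Finset.mem_univ _, hξ⟩
      rw [← Finsupp.degree_eq_sum, ← Finsupp.degree_eq_sum, ha.1, hb.1] at h1
      exact lt_irrefl _ h1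
    refine hex ρ hρ (or_iff_not_imp_left.2 fun hne => ?_)
    exact lt_of_le_of_ne (ha.2 _) (hfull _ (Ne.symm hne))

theorem exists_blocks {V : Type*} [Finite V] {G : SimpleGraph V} (h : G.IsCompleteMultipartite) :
    ∃ k : V → ℕ, ∀ x y, G.Adj x y ↔ k x ≠ k y := by
  obtain ⟨n, ⟨e⟩⟩ := Finite.exists_equiv_fin (Quotient h.setoid)
  refine ⟨fun x => e (Quotient.mk h.setoid x), fun x y => ?_⟩
  rw [Ne, Fin.val_inj, e.apply_eq_iff_eq, Quotient.eq]
  exact not_not.symm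

end EdgeIdeal

end EdgeIdealPowers

open EdgeIdealPowers in
theorem theorem3p1 {V : Type*} [Finite V] (G : SimpleGraph V)
    (hG : ∀ v : V, ∃ w : V, G.Adj v w) (K : Type*) [Field K] :
    List.TFAE [
      ∃ q : ℕ, 1 ≤ q ∧ EdgeIdealPowers.IsPolymatroid
        (EdgeIdealPowers.minimalGenerators (EdgeIdealPowers.edgeIdeal K G ^ q)),
      ∀ q : ℕ, 1 ≤ q → EdgeIdealPowers.IsPolymatroid
        (EdgeIdealPowers.minimalGenerators (EdgeIdealPowers.edgeIdeal K G ^ q)),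
      G.IsCompleteMultipartite] ∧
    (G.IsCompleteMultipartite → ∀ q : ℕ, 1 ≤ q →
      Ideal.span (EdgeIdealPowers.symmetricExchangeBinomials K
          (EdgeIdealPowers.minimalGenerators (EdgeIdealPowers.edgeIdeal K G ^ q))) =
        EdgeIdealPowers.toricIdeal K
          (EdgeIdealPowers.minimalGenerators (EdgeIdealPowers.edgeIdeal K G ^ q))) := by
  have := Fintype.ofFinite V
  refine ⟨?_, fun h q hq => ?_⟩
  · tfae_have 2 → 1 := fun h => ⟨1, le_rfl, h 1 le_rfl⟩
    tfae_have 1 → 3 := by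
      rintro ⟨q, hq, h⟩
      rw [minimalGenerators_edgeIdeal_pow] at h
      exact isCompleteMultipartite_of_isPolymatroid hG hq h
    tfae_have 3 → 2 := by
      intro h q _
      obtain ⟨k, hk⟩ := exists_blocks h
      rw [minimalGenerators_edgeIdeal_pow, nsmul_edgeVectors_eq_cappedBlocks hk]
      exact isPolymatroid_cappedBlocks k q
    tfae_finish
  · obtain ⟨k, hk⟩ := exists_blocks h
    rw [minimalGenerators_edgeIdeal_pow, nsmul_edgeVectors_eq_cappedBlocks hk]
    exact span_symmetricExchangeBinomials_eq K (d := 2 * q) (by omega) (fun a ha => ha.1)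
      fun N U W hUW => exists_common_reduct hUW
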